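/- Let $\omega=\frac{-1+\sqrt{-3}}{2}$, let $E_\omega=\mathbf C/(\mathbf Z+\mathbf Z\omega)$, and let $M=E_\omega\times E_\omega\times E_\omega$. For a holomorphic automorphism $f$ of $M$ and $p\ge 0$, the $p$-th dynamical degree is $$\lambda_p(f)=\lim_{n\to\infty} r_p(f^n)^{1/n},$$ where $r_p(g)$ denotes the spectral radius of $g^*$ on $H^{p,p}(M)$. A Salem number is a real algebraic integer $s>1$ such that $1/s$ is a Galois conjugate of $s$ and all Galois conjugates of $s$ other than $s$ and $1/s$ lie on the unit circle. Let $a\ge 1$ be an integer and let $f=f_a$ be the automorphism of $M$ given by the matrix $$P_a=\begin{pmatrix}0&1&0\\0&0&1\\-1&3a^2&0\end{pmatrix}\in \mathrm{GL}(3,\mathbf Z).$$ The characteristic polynomial of $P_a$ is $x^3-3a^2x+1$. It has three real roots $\alpha,\beta,\gamma$, which can be labelled so that $|\beta|<1<|\gamma|<|\alpha|$, and the limits defining $\lambda_1(f)$ and $\lambda_2(f)$ exist and satisfy $$\lambda_1(f)=\alpha^2,\qquad \lambda_2(f)=\alpha^2\gamma^2,\qquad \lambda_2(f)>\lambda_1(f)>1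 .$$ Moreover, $\lambda_1(f)$ is not a Salem number. -/

import Mathlib

open scoped ContDiff Topology ENNReal
open Filter Polynomial

noncomputable section

namespace EisensteinTorus

/-! ### The complex torus `M = E_ω × E_ω × E_ω` -/

/-- `ω = (-1 + √-3) / 2`. -/
def omega : ℂ := (-1 + (Real.sqrt 3 : ℂ) * Complex.I) / 2

/-- The lattice `ℤ + ℤ ω` in `ℂ`. -/
def lattice : AddSubgroup ℂ := AddSubgroup.closure {1, omega}

/-- The elliptic curve `E_ω = ℂ / (ℤ + ℤ ω)`. -/
abbrev E : Type := ℂ ⧸ lattice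

/-- The complex torus `E_ω × E_ω × E_ω`. -/
abbrev M : Type := Fin 3 → E

/-- The universal cover `ℂ³` of `M`; it is also the tangent space of `M` at every point, through
the differential of the covering map. -/
abbrev V : Type := Fin 3 → ℂ

/-- The covering map `ℂ³ → M`. -/
def proj (z : V) : M := fun i => (z i : E)

lemma proj_surjective : Function.Surjective proj := by
  intro x
  choose z hz using fun i => QuotientAddGroup.mk_surjective (x i)
  exact ⟨z, funext hz⟩

lemma proj_add (z w : V) : proj (z + w) = proj z + proj w := rfl

lemma proj_sub (z w : V) : proj (z - w) = proj z - proj w := rfl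

lemma one_le_norm_of_mem_lattice {z : ℂ} (hz : z ∈ lattice) (h0 : z ≠ 0) : 1 ≤ ‖z‖ := by
  obtain ⟨m, n, rfl⟩ := AddSubgroup.mem_closure_pair.1 hz
  have hs : Real.sqrt 3 * Real.sqrt 3 = 3 := Real.mul_self_sqrt (by norm_num)
  have key : Complex.normSq (m • (1 : ℂ) + n • omega) = ((m * m - m * n + n * n : ℤ) : ℝ) := by
    rw [Complex.normSq_apply]
    simp [omega]
    linear_combination (n : ℝ) * n / 4 * hs
  have hpos : 0 < Complex.normSq (m • (1 : ℂ) + n • omega) := Complex.normSq_pos.2 h0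
  rw [key] at hpos
  have h1 : (1 : ℤ) ≤ m * m - m * n + n * n := by
    have : (0 : ℤ) < m * m - m * n + n * n := by exact_mod_cast hpos
    omega
  have h2 : (1 : ℝ) ≤ Complex.normSq (m • (1 : ℂ) + n • omega) := by
    rw [key]; exact_mod_cast h1
  rw [Complex.normSq_eq_norm_sq] at h2
  nlinarith [norm_nonneg (m • (1 : ℂ) + n • omega)]

/-- The fibres of the covering map are discrete. -/
lemma eq_zero_of_proj_eq_zero {z : V} (hz : proj z = 0) (h : ‖z‖ < 1) : z = 0 := by
  funext i
  by_contra h0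
  have hi : z i ∈ lattice := (QuotientAddGroup.eq_zero_iff _).1 (congrFun hz i)
  exact absurd ((one_le_norm_of_mem_lattice hi h0).trans (norm_le_pi_norm z i)) (not_le.2 h)

/-! ### Holomorphic self-maps of `M` and their differentials -/

/-- `F` is a holomorphic lift of `g : M → M` to `ℂ³` near the point `z`. -/
def IsHolLiftAt (g : M → M) (F : V → V) (z : V) : Prop :=
  AnalyticAt ℂ F z ∧ ∀ᶠ w in 𝓝 z, proj (F w) = g (proj w)

/-- A self-map of `M` is holomorphic if it has holomorphic local lifts to `ℂ³` (the local inverses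
of the covering map are the charts of `M`). -/
def IsHolomorphic (g : M → M) : Prop := ∀ z : V, ∃ F : V → V, IsHolLiftAt g F z

open Classical in
/-- The differential of `g` at `x`, read in `T_x M = ℂ³ = T_{g x} M`: the derivative of any
holomorphic local lift of `g` at any point over `x` (see `differential_eq`). -/
def differential (g : M → M) (x : M) : V →L[ℂ] V :=
  if h : ∃ q : V × (V → V), proj q.1 = x ∧ IsHolLiftAt g q.2 q.1 then
    fderiv ℂ h.choose.2 h.choose.1
  else 0

lemma fderiv_eq_of_lifts {g : M → M} {F F' : V → V} {z z' : V} (hz : proj z = proj z')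
    (h : IsHolLiftAt g F z) (h' : IsHolLiftAt g F' z') : fderiv ℂ F z = fderiv ℂ F' z' := by
  set l : V := z' - z with hl
  have hpl : proj l = 0 := by rw [hl, proj_sub, hz, sub_self]
  have hzl : z + l = z' := by rw [hl]; abel
  have ht : Tendsto (fun w : V => w + l) (𝓝 z) (𝓝 z') := by
    rw [← hzl]; exact (continuous_id.add continuous_const).tendsto z
  have hcF : Tendsto F (𝓝 z) (𝓝 (F z)) := h.1.continuousAt
  have hcF' : Tendsto (fun w => F' (w + l)) (𝓝 z) (𝓝 (F' z')) :=
    (h'.1.continuousAt.tendsto).comp ht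
  have hc : Tendsto (fun w => F' (w + l) - F w - (F' z' - F z)) (𝓝 z) (𝓝 0) := by
    have := (hcF'.sub hcF).sub_const (F' z' - F z)
    simpa using this
  have hsmall : ∀ᶠ w in 𝓝 z, ‖F' (w + l) - F w - (F' z' - F z)‖ < 1 := by
    have := hc.norm
    rw [norm_zero] at this
    exact this.eventually_lt_const one_pos
  have hlift' : ∀ᶠ w in 𝓝 z, proj (F' (w + l)) = g (proj (w + l)) := ht.eventually h'.2
  have h0 := h.2.self_of_nhds
  have h0' := h'.2.self_of_nhds
  have hev : (fun w => F' (w + l)) =ᶠ[𝓝 z] fun w => F w + (F' z' - F z) := by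
    filter_upwards [hsmall, hlift', h.2] with w hw1 hw2 hw3
    have : F' (w + l) - F w - (F' z' - F z) = 0 := by
      apply eq_zero_of_proj_eq_zero _ hw1
      rw [proj_sub, proj_sub, proj_sub, hw2, hw3, h0, h0', proj_add, hpl, hz]
      simp
    rw [sub_eq_zero] at this
    rw [← this]; abel
  have e1 := hev.fderiv_eq (𝕜 := ℂ)
  rw [fderiv_comp_add_right, hzl, fderiv_add_const] at e1
  exact e1.symm

lemma differential_eq {g : M → M} {F : V → V} {z : V} (h : IsHolLiftAt g F z) :
    differential g (proj z) = fderiv ℂ F z := by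
  have hex : ∃ q : V × (V → V), proj q.1 = proj z ∧ IsHolLiftAt g q.2 q.1 := ⟨(z, F), rfl, h⟩
  rw [differential, dif_pos hex]
  exact fderiv_eq_of_lifts hex.choose_spec.1 hex.choose_spec.2 h

lemma isHolomorphic_id : IsHolomorphic id := fun _ =>
  ⟨id, analyticAt_id, Eventually.of_forall fun _ => rfl⟩

lemma IsHolomorphic.comp {g h : M → M} (hg : IsHolomorphic g) (hh : IsHolomorphic h) :
    IsHolomorphic (g ∘ h) := by
  intro z
  obtain ⟨H, hH, hH'⟩ := hh z
  obtain ⟨G, hG, hG'⟩ := hg (H z)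
  refine ⟨G ∘ H, hG.comp hH, ?_⟩
  filter_upwards [hH', hH.continuousAt.eventually hG'] with w h1 h2
  simp only [Function.comp_apply]
  rw [h2, h1]

lemma IsHolomorphic.iterate {g : M → M} (hg : IsHolomorphic g) (n : ℕ) :
    IsHolomorphic g^[n] := by
  induction n with
  | zero => exact isHolomorphic_id
  | succ n ih => exact ih.comp hg

/-- Biholomorphic automorphisms of `M`. -/
structure Aut extends M ≃ M where
  hol : IsHolomorphic toFun
  hol_symm : IsHolomorphic invFun

/-! ### Complex-valued differential forms on `M` -/

/-- Complex-valued alternating `k`-forms over `ℝ` on the tangent space `ℂ³`. -/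
abbrev Alt (k : ℕ) : Type := V [⋀^Fin k]→L[ℝ] ℂ

/-- Smooth complex-valued differential `k`-forms on `M`, as functions on `M` with values in the
alternating forms on the tangent space; smoothness is tested after pulling back to `ℂ³`. -/
def smoothForms (k : ℕ) : Submodule ℂ (M → Alt k) where
  carrier := {η | ContDiff ℝ ∞ fun z : V => η (proj z)}
  add_mem' {η θ} h₁ h₂ := by
    simp only [Set.mem_ofPred_eq] at h₁ h₂ ⊢
    exact h₁.add h₂
  zero_mem' := by
    simp only [Set.mem_ofPred_eq]
    exact contDiff_const
  smul_mem' c η h := by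
    simp only [Set.mem_ofPred_eq] at h ⊢
    exact h.const_smul c

/-- The complex vector space `Ω^k(M)` of smooth `k`-forms on `M`. -/
def Form (k : ℕ) : Type := smoothForms k

instance (k : ℕ) : AddCommGroup (Form k) := inferInstanceAs (AddCommGroup (smoothForms k))

instance (k : ℕ) : Module ℂ (Form k) := inferInstanceAs (Module ℂ (smoothForms k))

/-- The pullback to `ℂ³` of the form `η` on `M`. -/
def lift {k : ℕ} (η : M → Alt k) (z : V) : Alt k := η (proj z)

/-- The exterior derivative on `M`: the form whose pullback to `ℂ³` is the exterior derivative of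
the pullback (see `lift_extD`; the chosen point over `x` does not matter). -/
def extD {k : ℕ} (η : M → Alt k) (x : M) : Alt (k + 1) :=
  extDeriv (lift η) (Function.surjInv proj_surjective x)

lemma lift_extD {k : ℕ} (η : M → Alt k) : lift (extD η) = extDeriv (lift η) := by
  funext z
  set z' : V := Function.surjInv proj_surjective (proj z) with hz'
  have hp : proj z' = proj z := Function.surjInv_eq proj_surjective _
  have hper : (fun w : V => lift η (w + (z' - z))) = lift η := by
    funext w
    simp only [lift]
    rw [proj_add, proj_sub, hp, sub_self, add_zero]
  have hf : fderiv ℝ (lift η) z = fderiv ℝ (lift η) z' := by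
    conv_lhs => rw [← hper]
    rw [fderiv_comp_add_right, add_sub_cancel]
  change extDeriv (lift η) z' = extDeriv (lift η) z
  simp only [extDeriv, hf]

lemma Form.contDiff {k : ℕ} {η : M → Alt k} (h : η ∈ smoothForms k) : ContDiff ℝ ∞ (lift η) := h

lemma extDeriv_contDiff {k : ℕ} {η : V → Alt k} (h : ContDiff ℝ ∞ η) :
    ContDiff ℝ ∞ (extDeriv η) := by
  have h1 : ContDiff ℝ ∞ (fderiv ℝ η) := h.fderiv_right (by simp)
  exact (ContinuousAlternatingMap.alternatizeUncurryFinCLM ℝ V ℂ (n := k)).contDiff.comp h1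

lemma extDeriv_const_smul {k : ℕ} {η : V → Alt k} (h : ContDiff ℝ ∞ η) (c : ℂ) (z : V) :
    extDeriv (fun w => c • η w) z = c • extDeriv η z := by
  have hd : DifferentiableAt ℝ η z := h.contDiffAt.differentiableAt (by simp)
  have e : fderiv ℝ (fun w => c • η w) z = c • fderiv ℝ η z := fderiv_const_smul hd c
  ext v
  simp only [extDeriv, e, ContinuousAlternatingMap.alternatizeUncurryFin_apply,
    smul_apply, ContinuousAlternatingMap.smul_apply, Finset.smul_sum]
  exact Finset.sum_congr rfl fun i _ => smul_comm _ _ _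

lemma two_le_smooth : minSmoothness ℝ 2 ≤ (∞ : WithTop ℕ∞) := by
  rw [minSmoothness_of_isRCLikeNormedField]
  exact WithTop.coe_le_coe.2 le_top

lemma lift_injective {k : ℕ} {η θ : M → Alt k} (h : lift η = lift θ) : η = θ := by
  funext x
  obtain ⟨z, rfl⟩ := proj_surjective x
  exact congrFun h z

/-- The exterior derivative `d : Ω^k(M) → Ω^{k+1}(M)` as a linear map. -/
def d (k : ℕ) : Form k →ₗ[ℂ] Form (k + 1) where
  toFun η := ⟨extD η.1, by
    change ContDiff ℝ ∞ (lift (extD η.1))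
    rw [lift_extD]
    exact extDeriv_contDiff η.2⟩
  map_add' η θ := by
    apply Subtype.ext
    apply lift_injective
    rw [lift_extD]
    funext z
    have h1 : DifferentiableAt ℝ (lift η.1) z :=
      (Form.contDiff η.2).contDiffAt.differentiableAt (by simp)
    have h2 : DifferentiableAt ℝ (lift θ.1) z :=
      (Form.contDiff θ.2).contDiffAt.differentiableAt (by simp)
    have h3 : lift (extD η.1) z + lift (extD θ.1) z
        = extDeriv (lift η.1 + lift θ.1) z := by
      rw [lift_extD, lift_extD, extDeriv_add h1 h2]
    exact h3.symm
  map_smul' c η := by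
    apply Subtype.ext
    apply lift_injective
    rw [lift_extD]
    funext z
    have h3 : c • lift (extD η.1) z = extDeriv (fun w => c • lift η.1 w) z := by
      rw [lift_extD, extDeriv_const_smul (Form.contDiff η.2)]
    exact h3.symm

lemma d_d {k : ℕ} (η : Form k) : d (k + 1) (d k η) = 0 := by
  apply Subtype.ext
  apply lift_injective
  change lift (extD (extD η.1)) = 0
  rw [lift_extD, lift_extD]
  exact extDeriv_extDeriv (Form.contDiff η.2) two_le_smooth

/-! ### Pullback of forms by holomorphic maps -/

/-- Pullback of a form: `(g^* η)_x = η_{g x} ∘ (dg_x × ⋯ × dg_x)`. -/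
def pullbackFun {k : ℕ} (g : M → M) (η : M → Alt k) (x : M) : Alt k :=
  (η (g x)).compContinuousLinearMap ((differential g x).restrictScalars ℝ)

lemma lift_pullback_eventuallyEq {k : ℕ} {g : M → M} (η : M → Alt k) {F : V → V} {z : V}
    (h : IsHolLiftAt g F z) : lift (pullbackFun g η) =ᶠ[𝓝 z]
      fun w => (lift η (F w)).compContinuousLinearMap (fderiv ℝ F w) := by
  filter_upwards [h.1.eventually_analyticAt, h.2.eventually_nhds] with w h1 h2
  have hd : differential g (proj w) = fderiv ℂ F w := differential_eq ⟨h1, h2⟩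
  have hr : fderiv ℝ F w = (fderiv ℂ F w).restrictScalars ℝ :=
    h1.differentiableAt.fderiv_restrictScalars ℝ
  simp only [lift, pullbackFun]
  rw [hd, hr, h2.self_of_nhds]

lemma contDiffAt_compContinuousLinearMap {k : ℕ} {A : V → Alt k} {L : V → V →L[ℝ] V} {z : V}
    (hA : ContDiffAt ℝ ∞ A z) (hL : ContDiffAt ℝ ∞ L z) :
    ContDiffAt ℝ ∞ (fun w => (A w).compContinuousLinearMap (L w)) z := by
  have hsmooth : ContDiff ℝ ∞
      (fun q : Alt k × (V →L[ℝ] V) => q.1.compContinuousLinearMap q.2) := by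
    let CM := ContinuousMultilinearMap ℝ (fun _ : Fin k => V) ℂ
    let T : Alt k →L[ℝ] CM := ContinuousAlternatingMap.toContinuousMultilinearMapCLM ℝ
    have hT : Function.Injective T := ContinuousAlternatingMap.toContinuousMultilinearMap_injective
    have : FiniteDimensional ℝ CM := FiniteDimensional.of_injective
      (ContinuousMultilinearMap.toMultilinearMapLinear (R' := ℝ) (A := ℝ))
      ContinuousMultilinearMap.toMultilinearMap_injective
    obtain ⟨g, hg⟩ := T.toLinearMap.exists_leftInverse_of_injective (LinearMap.ker_eq_bot.2 hT)
    have hc : ContDiff ℝ ∞ (fun q : Alt k × (V →L[ℝ] V) =>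
        ContinuousMultilinearMap.compContinuousLinearMapContinuousMultilinear ℝ
          (fun _ : Fin k => V) (fun _ => V) ℂ (fun _ => q.2) (T q.1)) := by
      refine ContDiff.clm_apply ?_ (T.contDiff.comp contDiff_fst)
      exact (ContinuousMultilinearMap.contDiff _).comp (contDiff_pi.2 fun _ => contDiff_snd)
    have h2 := (LinearMap.toContinuousLinearMap g).contDiff.comp hc (n := ∞)
    convert h2 using 2 with q
    exact (LinearMap.congr_fun hg (q.1.compContinuousLinearMap q.2)).symm
  exact hsmooth.contDiffAt.comp z (hA.prodMk hL)

lemma pullbackFun_mem {k : ℕ} {g : M → M} (hg : IsHolomorphic g) {η : M → Alt k}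
    (hη : η ∈ smoothForms k) : pullbackFun g η ∈ smoothForms k := by
  change ContDiff ℝ ∞ (lift (pullbackFun g η))
  rw [contDiff_iff_contDiffAt]
  intro z
  obtain ⟨F, hF⟩ := hg z
  have hFs : ContDiffAt ℝ ∞ F z := hF.1.contDiffAt.restrict_scalars ℝ
  have h1 : ContDiffAt ℝ ∞ (fun w => lift η (F w)) z :=
    (Form.contDiff hη).contDiffAt.comp z hFs
  have h2 : ContDiffAt ℝ ∞ (fderiv ℝ F) z := hFs.fderiv_right (by simp)
  refine ContDiffAt.congr_of_eventuallyEq ?_ (lift_pullback_eventuallyEq η hF)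
  exact contDiffAt_compContinuousLinearMap h1 h2

lemma extD_pullbackFun {k : ℕ} {g : M → M} (hg : IsHolomorphic g) {η : M → Alt k}
    (hη : η ∈ smoothForms k) : extD (pullbackFun g η) = pullbackFun g (extD η) := by
  apply lift_injective
  rw [lift_extD]
  funext z
  obtain ⟨F, hF⟩ := hg z
  have hFs : ContDiffAt ℝ ∞ F z := hF.1.contDiffAt.restrict_scalars ℝ
  rw [(lift_pullback_eventuallyEq η hF).extDeriv_eq,
    (lift_pullback_eventuallyEq (extD η) hF).self_of_nhds, lift_extD]
  exact extDeriv_pullback ((Form.contDiff hη).contDiffAt.differentiableAt (by simp)) hFs two_le_smooth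

/-- The linear map `g^* : Ω^k(M) → Ω^k(M)`. -/
def pullback (k : ℕ) (g : M → M) (hg : IsHolomorphic g) : Form k →ₗ[ℂ] Form k where
  toFun η := ⟨pullbackFun g η.1, pullbackFun_mem hg η.2⟩
  map_add' _ _ := rfl
  map_smul' _ _ := rfl

lemma d_pullback {k : ℕ} {g : M → M} (hg : IsHolomorphic g) (η : Form k) :
    d k (pullback k g hg η) = pullback (k + 1) g hg (d k η) :=
  Subtype.ext (extD_pullbackFun hg η.2)

/-! ### De Rham cohomology and its `(p,q)`-parts -/

/-- Closed `k`-forms. -/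
abbrev Closed (k : ℕ) : Submodule ℂ (Form k) := LinearMap.ker (d k)

/-- Exact `k`-forms. -/
def Exact : (k : ℕ) → Submodule ℂ (Form k)
  | 0 => ⊥
  | k + 1 => LinearMap.range (d k)

/-- The de Rham cohomology `H^k(M, ℂ)`: closed forms modulo exact forms. -/
abbrev DeRham (k : ℕ) : Type := Closed k ⧸ (Exact k).submoduleOf (Closed k)

/-- An alternating form on `ℂ³` of degree `p + q` is of type `(p,q)`, i.e. a combination of the
`dz_I ∧ dz̄_J` with `|I| = p` and `|J| = q`, iff the scalars `u` act on it by `u^p ū^q`. -/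
def IsType (p q : ℕ) (η : Alt (p + q)) : Prop :=
  ∀ (u : ℂ) (v : Fin (p + q) → V),
    η (fun i => u • v i) = u ^ p * (starRingEnd ℂ u) ^ q * η v

/-- Closed forms of type `(p,q)`. -/
def ClosedType (p q : ℕ) : Submodule ℂ (Closed (p + q)) where
  carrier := {η | ∀ x, IsType p q (η.1.1 x)}
  add_mem' {η θ} h₁ h₂ x u v := by
    have e1 := h₁ x u v
    have e2 := h₂ x u v
    change η.1.1 x _ + θ.1.1 x _ = _ * (η.1.1 x _ + θ.1.1 x _)
    rw [e1, e2]; ring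
  zero_mem' x u v := (mul_zero _).symm
  smul_mem' c η h x u v := by
    have e1 := h x u v
    change c * η.1.1 x _ = _ * (c * η.1.1 x _)
    rw [e1]; ring

/-- `H^{p,q}(M)`: the classes in `H^{p+q}(M, ℂ)` represented by closed forms of type `(p,q)`. -/
def Hodge (p q : ℕ) : Submodule ℂ (DeRham (p + q)) :=
  (ClosedType p q).map (Submodule.mkQ _)

/-- `g^*` on closed forms. -/
def pullbackClosed (k : ℕ) (g : M → M) (hg : IsHolomorphic g) : Closed k →ₗ[ℂ] Closed k :=
  (pullback k g hg).restrict fun η hη => by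
    rw [LinearMap.mem_ker] at hη ⊢
    rw [d_pullback, hη, map_zero]

lemma pullback_mem_exact {k : ℕ} {g : M → M} (hg : IsHolomorphic g) {η : Form k}
    (h : η ∈ Exact k) : pullback k g hg η ∈ Exact k := by
  cases k with
  | zero =>
    have h0 : η = 0 := h
    rw [h0, map_zero]
    exact Submodule.zero_mem _
  | succ k =>
    obtain ⟨θ, rfl⟩ := h
    exact ⟨pullback k g hg θ, d_pullback hg θ⟩

/-- `g^*` on `H^k(M, ℂ)`. -/
def pullbackDeRham (k : ℕ) (g : M → M) (hg : IsHolomorphic g) : DeRham k →ₗ[ℂ] DeRham k :=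
  Submodule.mapQ _ _ (pullbackClosed k g hg) fun _ h => pullback_mem_exact hg h

lemma pullbackClosed_mem_type {p q : ℕ} {g : M → M} (hg : IsHolomorphic g)
    {η : Closed (p + q)} (h : η ∈ ClosedType p q) :
    pullbackClosed (p + q) g hg η ∈ ClosedType p q := by
  intro x u v
  change η.1.1 (g x) (fun i => differential g x (u • v i)) =
    _ * η.1.1 (g x) (fun i => differential g x (v i))
  rw [← h (g x) u]
  simp only [map_smul]

/-- `g^*` on `H^{p,q}(M)`. -/
def pullbackHodge (p q : ℕ) (g : M → M) (hg : IsHolomorphic g) :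
    Module.End ℂ (Hodge p q) :=
  (pullbackDeRham (p + q) g hg).restrict (p := Hodge p q) (q := Hodge p q) <| by
    rintro _ ⟨η, hη, rfl⟩
    exact ⟨pullbackClosed (p + q) g hg η, pullbackClosed_mem_type hg hη, rfl⟩

/-! ### Dynamical degrees -/

/-- `r_p(g)`: the spectral radius of `g^*` on `H^{p,p}(M)`. -/
def specRad (p : ℕ) (g : M → M) (hg : IsHolomorphic g) : ℝ≥0∞ :=
  spectralRadius ℂ (pullbackHodge p p g hg)

/-- `l` is the `p`-th dynamical degree of `f`, i.e. the limit of `r_p(f^n)^{1/n}` exists and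
equals `l`. -/
def IsDynamicalDegree (p : ℕ) (f : Aut) (l : ℝ) : Prop :=
  0 ≤ l ∧ Tendsto (fun n : ℕ => specRad p f.toFun^[n] (f.hol.iterate n) ^ (1 / (n : ℝ))) atTop
    (𝓝 (ENNReal.ofReal l))

/-! ### Automorphisms given by integer matrices -/

/-- The action of an integer matrix on `M`. -/
def matMap (P : Matrix (Fin 3) (Fin 3) ℤ) (x : M) : M := fun i => ∑ j, P i j • x j

lemma matMap_matMap (P Q : Matrix (Fin 3) (Fin 3) ℤ) (x : M) :
    matMap P (matMap Q x) = matMap (P * Q) x := by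
  funext i
  simp only [matMap, Matrix.mul_apply, Finset.smul_sum, smul_smul]
  rw [Finset.sum_comm]
  refine Finset.sum_congr rfl fun j _ => ?_
  exact (map_sum (zmultiplesHom E (x j)) _ _).symm

lemma matMap_one (x : M) : matMap 1 x = x := by
  funext i
  simp [matMap, Matrix.one_apply, ite_smul]

lemma isHolomorphic_matMap (P : Matrix (Fin 3) (Fin 3) ℤ) : IsHolomorphic (matMap P) := by
  intro z
  refine ⟨fun w i => ∑ j, P i j • w j, ?_, Eventually.of_forall fun w => ?_⟩
  · let L : V →ₗ[ℂ] V :=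
      { toFun := fun w i => ∑ j, P i j • w j
        map_add' := fun w w' => by
          funext i; simp [smul_add, Finset.sum_add_distrib]
        map_smul' := fun c w => by
          funext i; simp [Finset.mul_sum, mul_left_comm] }
    exact (LinearMap.toContinuousLinearMap L).analyticAt z
  · funext i
    simp only [proj, matMap]
    exact map_sum (QuotientAddGroup.mk' lattice) _ _

/-- The automorphism of `M` given by an element of `GL(3, ℤ)`. -/
def autOfGL (P : GL (Fin 3) ℤ) : Aut where
  toFun := matMap P.val
  invFun := matMap P.inv
  left_inv x := by rw [matMap_matMap, P.inv_val, matMap_one]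
  right_inv x := by rw [matMap_matMap, P.val_inv, matMap_one]
  hol := isHolomorphic_matMap _
  hol_symm := isHolomorphic_matMap _

/-- The matrix `P_a`, an element of `GL(3, ℤ)`. -/
def P (a : ℕ) : GL (Fin 3) ℤ where
  val := !![0, 1, 0; 0, 0, 1; -1, 3 * (a : ℤ) ^ 2, 0]
  inv := !![3 * (a : ℤ) ^ 2, 0, -1; 1, 0, 0; 0, 1, 0]
  val_inv := by
    ext i j
    fin_cases i <;> fin_cases j <;> simp [Matrix.mul_apply, Fin.sum_univ_three]
  inv_val := by
    ext i j
    fin_cases i <;> fin_cases j <;> simp [Matrix.mul_apply, Fin.sum_univ_three]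

/-- The automorphism `f_a` of `M` given by the matrix `P_a`. -/
def f (a : ℕ) : Aut := autOfGL (P a)

/-! ### Salem numbers -/

/-- A Salem number: a real algebraic integer `s > 1` such that `1/s` is a Galois conjugate of `s`
and all Galois conjugates other than `s` and `1/s` lie on the unit circle. -/
def IsSalem (s : ℝ) : Prop :=
  1 < s ∧ IsIntegral ℤ s ∧ aeval (s⁻¹) (minpoly ℚ s) = 0 ∧
    ∀ z : ℂ, aeval z (minpoly ℚ s) = 0 → z = (s : ℂ) ∨ z = ((s⁻¹ : ℝ) : ℂ) ∨ ‖z‖ = 1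

end EisensteinTorus

end

/-! The cohomology of a torus is carried by constant forms. Averaging a closed form of positive
degree along the six lattice periods makes it constant and changes it only by the derivative of a
periodic form; conversely, averaging `dθ = c` shows that an exact constant form vanishes. This is
`constClass_bijective`.

On constant forms an integer matrix acts by precomposition with its linear lift. When its
eigenvalues `α, β, γ` are real, the eigenvalues in degree `2p` are products of `2p` distinct entries
of the list `α, α, β, β, γ, γ`. For `p = 1` the largest modulus is `α²`. For `p = 2`, since the six
entries have product `1`, it is the inverse of the smallest product of two entries, `β⁻² = α²γ²`.
Both values occur on wedges of coordinates with their conjugates, which have type `(p,p)`. So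
`r_p(f^n)` is exactly an `n`-th power and the limit is immediate (`specRad_matMap_eq`,
`isDynamicalDegree_autOfGL`).

For the Salem claim, every conjugate of `α²` is one of `α², β², γ²`. If `α⁻²` were a conjugate it
would have to be `β²`, and then `(αβγ)² = 1` would force `γ² = 1`, contrary to `|γ| > 1`.
Irreducibility of the cubic plays no role. -/

noncomputable section

namespace EisensteinTorus

/-! ### Weighted integrals along a direction -/

section DirInt

variable {W F : Type} [NormedAddCommGroup W] [NormedSpace ℝ W] [NormedAddCommGroup F]
  [NormedSpace ℝ F]

/-- The integral of `G` along the segment from `z` to `z + e`, with weight `w`. -/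
def dirInt (w : ℝ → ℝ) (e : W) (G : W → F) (z : W) : F :=
  ∫ t in (0 : ℝ)..1, w t • G (z + t • e)

lemma continuous_dirInt_integrand {w : ℝ → ℝ} (hw : Continuous w) (e : W) {G : W → F}
    (hG : Continuous G) (z : W) : Continuous fun t : ℝ => w t • G (z + t • e) := by
  fun_prop

/-- Differentiation under the integral sign. The dominating constant comes from compactness of the
closed unit ball times `[0, 1]`, which is where finite dimension enters. -/
lemma hasFDerivAt_dirInt [FiniteDimensional ℝ W] {w : ℝ → ℝ} (hw : Continuous w) (e : W)
    {G : W → F} (hG : ContDiff ℝ 1 G) (z : W) :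
    HasFDerivAt (dirInt w e G) (dirInt w e (fderiv ℝ G) z) z := by
  have hG' : Continuous (fderiv ℝ G) := hG.continuous_fderiv (by simp)
  have hjoint : Continuous fun q : W × ℝ => w q.2 • fderiv ℝ G (q.1 + q.2 • e) := by fun_prop
  have : ProperSpace W := FiniteDimensional.proper ℝ W
  obtain ⟨B, hB⟩ := ((isCompact_closedBall z 1).prod (isCompact_Icc (a := (0 : ℝ)) (b := 1))
    ).exists_bound_of_continuousOn hjoint.continuousOn
  refine intervalIntegral.hasFDerivAt_integral_of_dominated_of_fderiv_le
    (F := fun x t => w t • G (x + t • e)) (F' := fun x t => w t • fderiv ℝ G (x + t • e))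
    (bound := fun _ => B) (Metric.closedBall_mem_nhds z one_pos) ?_ ?_ ?_ ?_ ?_ ?_
  · exact Eventually.of_forall fun x =>
      (continuous_dirInt_integrand hw e hG.continuous x).aestronglyMeasurable
  · exact (continuous_dirInt_integrand hw e hG.continuous z).intervalIntegrable _ _
  · exact (continuous_dirInt_integrand hw e hG' z).aestronglyMeasurable
  · refine Eventually.of_forall fun t ht x hx => hB (x, t) ⟨hx, ?_⟩
    rw [Set.uIoc_of_le zero_le_one] at ht
    exact Set.Ioc_subset_Icc_self ht
  · exact intervalIntegrable_const
  · refine Eventually.of_forall fun t _ x _ => ?_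
    have h1 : HasFDerivAt G (fderiv ℝ G (x + t • e)) (x + t • e) :=
      (hG.differentiable (by simp) _).hasFDerivAt
    exact ((hasFDerivAt_comp_add_right (t • e)).2 h1).const_smul (w t)

lemma contDiff_dirInt [FiniteDimensional ℝ W] {w : ℝ → ℝ} (hw : Continuous w) (e : W)
    {G : W → F} (hG : ContDiff ℝ ∞ G) : ContDiff ℝ ∞ (dirInt w e G) := by
  rw [contDiff_infty]
  intro n
  -- The derivative is again a directional integral, but with values in `W →L[ℝ] F`, so the target
  -- space must vary.
  induction n generalizing F with
  | zero =>
    rw [Nat.cast_zero, contDiff_zero, continuous_iff_continuousAt]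
    exact fun z => (hasFDerivAt_dirInt hw e (hG.of_le (by simp)) z).continuousAt
  | succ n ih =>
    have h1 : ContDiff ℝ 1 G := hG.of_le (by simp)
    rw [Nat.cast_succ, contDiff_succ_iff_hasFDerivAt]
    exact ⟨dirInt w e (fderiv ℝ G), ih (hG.fderiv_right (by simp)),
      fun z => hasFDerivAt_dirInt hw e h1 z⟩

lemma clm_dirInt {F' : Type} [NormedAddCommGroup F'] [NormedSpace ℝ F'] [CompleteSpace F]
    [CompleteSpace F'] {w : ℝ → ℝ} (hw : Continuous w) (e : W) {G : W → F} (hG : Continuous G)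
    (T : F →L[ℝ] F') (z : W) : T (dirInt w e G z) = dirInt w e (fun x => T (G x)) z := by
  rw [dirInt, ← T.intervalIntegral_comp_comm
    ((continuous_dirInt_integrand hw e hG z).intervalIntegrable _ _)]
  simp [dirInt]

lemma dirInt_const [CompleteSpace F] (e : W) (c : F) :
    dirInt (fun _ => 1) e (fun _ : W => c) = fun _ => c := by
  funext z; simp [dirInt]

/-- Integration by parts against the weight `1 - t`. -/
lemma dirInt_one_sub_fderiv [CompleteSpace F] (e : W) {G : W → F} (hG : ContDiff ℝ 1 G)
    (z : W) : dirInt (fun t => 1 - t) e (fun x => fderiv ℝ G x e) z =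
      dirInt (fun _ => 1) e G z - G z := by
  have hG' : Continuous (fderiv ℝ G) := hG.continuous_fderiv (by simp)
  have hd : ∀ t : ℝ, HasDerivAt (fun t : ℝ => G (z + t • e)) (fderiv ℝ G (z + t • e) e) t := by
    intro t
    have h1 : HasFDerivAt G (fderiv ℝ G (z + t • e)) (z + t • e) :=
      (hG.differentiable (by simp) _).hasFDerivAt
    have h2 : HasDerivAt (fun t : ℝ => z + t • e) e t := by
      simpa using ((hasDerivAt_id t).smul_const e).const_add z
    exact h1.comp_hasDerivAt t h2
  have hu : ∀ t : ℝ, HasDerivAt (fun t : ℝ => 1 - t) (-1) t := fun t => by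
    simpa using (hasDerivAt_id t).const_sub 1
  -- The weight vanishes at `t = 1`, so the only boundary term is `-G z`; its derivative `-1`
  -- produces the plain average.
  have key := intervalIntegral.integral_smul_deriv_eq_deriv_smul_of_hasDerivAt
    (a := 0) (b := 1) (u := fun t : ℝ => 1 - t) (v := fun t : ℝ => G (z + t • e))
    (u' := fun _ => -1) (v' := fun t => fderiv ℝ G (z + t • e) e)
    (by fun_prop) (by have := hG.continuous; fun_prop)
    (fun t _ => hu t) (fun t _ => hd t) (by simp)
    ((by fun_prop : Continuous fun t : ℝ => fderiv ℝ G (z + t • e) e).intervalIntegrable _ _)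
  rw [dirInt, key]
  simp only [dirInt, neg_smul, one_smul, intervalIntegral.integral_neg]
  simp
  abel

/-- Averaging along a period yields a function that is constant in that direction. -/
lemma dirInt_one_add_smul {e : W} {G : W → F} (hper : ∀ z, G (z + e) = G z) (z : W) (s : ℝ) :
    dirInt (fun _ => 1) e G (z + s • e) = dirInt (fun _ => 1) e G z := by
  have hp : Function.Periodic (fun t : ℝ => G (z + t • e)) 1 := fun t => by
    simp only [add_smul, one_smul, ← add_assoc, hper]
  have h1 := hp.intervalIntegral_add_eq s 0
  have h2 := intervalIntegral.integral_comp_add_left (a := 0) (b := 1)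
    (fun t : ℝ => G (z + t • e)) s
  rw [zero_add] at h1
  rw [add_zero, h1] at h2
  simpa only [dirInt, one_smul, add_smul, add_assoc] using h2

lemma dirInt_add_right {w : ℝ → ℝ} {e : W} {G : W → F} {l : W} (hl : ∀ z, G (z + l) = G z)
    (z : W) : dirInt w e G (z + l) = dirInt w e G z := by
  simp only [dirInt, add_right_comm z l, hl]

end DirInt

/-! ### Exterior derivative, contraction and the averaging homotopy -/

section Forms
variable {k : ℕ}

lemma extDeriv_const_form (c : Alt k) : extDeriv (fun _ : V => c) = 0 := by
  funext z
  rw [extDeriv, fderiv_const_apply]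
  exact map_zero (ContinuousAlternatingMap.alternatizeUncurryFinCLM ℝ V ℂ (n := k))

/-- The exterior derivative is a continuous linear map (alternatization) applied to the derivative,
and both operations pass under the integral. -/
lemma extDeriv_dirInt {w : ℝ → ℝ} (hw : Continuous w) (e : V) {η : V → Alt k}
    (hη : ContDiff ℝ ∞ η) : extDeriv (dirInt w e η) = dirInt w e (extDeriv η) := by
  funext z
  have h1 : ContDiff ℝ 1 η := hη.of_le (by simp)
  rw [extDeriv, (hasFDerivAt_dirInt hw e h1 z).fderiv]
  exact clm_dirInt hw e (h1.continuous_fderiv (by simp))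
    (ContinuousAlternatingMap.alternatizeUncurryFinCLM ℝ V ℂ (n := k)) z

/-- Contraction of a form with the constant vector field `e`. -/
def contract (e : V) : Alt (k + 1) →L[ℝ] Alt k :=
  (ContinuousLinearMap.apply ℝ (Alt k) e).comp
    (ContinuousAlternatingMap.curryLeftLI (𝕜 := ℝ) (E := V) (F := ℂ)
      (n := k)).toContinuousLinearMap

lemma contract_apply (e : V) (η : Alt (k + 1)) (v : Fin k → V) :
    contract e η v = η (Fin.cons e v) := rfl

/-- Cartan's formula for a closed form and a constant vector field. -/
lemma extDeriv_contract (e : V) {η : V → Alt (k + 1)} (hη : Differentiable ℝ η) {z : V}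
    (hc : extDeriv η z = 0) : extDeriv (fun x => contract e (η x)) z = fderiv ℝ η z e := by
  have hd : fderiv ℝ (fun x => contract e (η x)) z = (contract e).comp (fderiv ℝ η z) :=
    ((contract e).hasFDerivAt.comp z (hη z).hasFDerivAt).fderiv
  ext v
  -- In `dη (e, v) = 0` the zeroth summand is the derivative of `η` along `e`; the others carry a
  -- shifted sign and add up to minus the exterior derivative of the contraction.
  have h0 := DFunLike.congr_fun hc (Fin.cons e v)
  rw [extDeriv, ContinuousAlternatingMap.alternatizeUncurryFin_apply, Fin.sum_univ_succ] at h0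
  rw [extDeriv, hd, ContinuousAlternatingMap.alternatizeUncurryFin_apply]
  simp only [ContinuousLinearMap.comp_apply, contract_apply]
  have hrem : ∀ i : Fin (k + 1), Fin.removeNth (α := fun _ => V) i.succ (Fin.cons e v) =
      Fin.cons (α := fun _ => V) e (Fin.removeNth i v) := by
    intro i
    funext j
    refine Fin.cases ?_ (fun j => ?_) j
    · simp [Fin.removeNth]
    · simp [Fin.removeNth]
  simp only [Fin.cons_succ, Fin.cons_zero, hrem, Fin.removeNth_zero, Fin.tail_cons, Fin.val_succ,
    Fin.val_zero, pow_zero, one_smul, pow_succ, mul_neg, mul_one, neg_smul,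
    Finset.sum_neg_distrib] at h0
  exact (add_neg_eq_zero.1 h0).symm

/-- On closed forms, averaging along a direction is chain homotopic to the identity. -/
lemma dirInt_one_eq_add_extDeriv (e : V) {η : V → Alt (k + 1)} (hη : ContDiff ℝ ∞ η)
    (hc : extDeriv η = 0) : dirInt (fun _ => 1) e η =
      η + extDeriv (dirInt (fun t => 1 - t) e fun x => contract e (η x)) := by
  have h1 : ContDiff ℝ 1 η := hη.of_le (by simp)
  -- By Cartan's formula, `d` of the weighted integral is the integral of `(1 - t) ∂_e η`, which
  -- integration by parts evaluates as the average minus `η`.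
  rw [extDeriv_dirInt (by fun_prop) e (η := fun x => contract e (η x))
    ((contract e).contDiff.comp hη)]
  have h2 : extDeriv (fun x => contract e (η x)) = fun x => fderiv ℝ η x e :=
    funext fun z => extDeriv_contract e (h1.differentiable (by simp)) (congrFun hc z)
  funext z
  rw [h2, Pi.add_apply, dirInt_one_sub_fderiv e h1, add_sub_cancel]

/-! ### Averages over the torus -/

/-- A function on `ℂ³` that is invariant under the deck transformations of `ℂ³ → M`. -/
def IsPeriodic {F : Type} (G : V → F) : Prop := ∀ l : V, proj l = 0 → ∀ z, G (z + l) = G z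

/-- Successive averages along a list of directions. -/
def avgList {F : Type} [NormedAddCommGroup F] [NormedSpace ℝ F] : List V → (V → F) → V → F
  | [], G => G
  | e :: l, G => dirInt (fun _ => 1) e (avgList l G)

section AvgList
variable {F : Type} [NormedAddCommGroup F] [NormedSpace ℝ F]

lemma contDiff_avgList (l : List V) {G : V → F} (hG : ContDiff ℝ ∞ G) :
    ContDiff ℝ ∞ (avgList l G) := by
  induction l with
  | nil => exact hG
  | cons e l ih => exact contDiff_dirInt continuous_const e ih

lemma avgList_const [CompleteSpace F] (l : List V) (c : F) :
    avgList l (fun _ => c) = fun _ => c := by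
  induction l with
  | nil => rfl
  | cons e l ih => rw [avgList, ih, dirInt_const]

lemma avgList_add_right (l : List V) {G : V → F} {v : V} (hv : ∀ z, G (z + v) = G z) (z : V) :
    avgList l G (z + v) = avgList l G z := by
  induction l generalizing z with
  | nil => exact hv z
  | cons e l ih => exact dirInt_add_right ih z

/-- Averaging along a period `e` removes the dependence on the direction `e`, and averaging
afterwards in other directions preserves this invariance. -/
lemma avgList_add_smul {l : List V} {G : V → F} (hG : IsPeriodic G) (hl : ∀ e ∈ l, proj e = 0)
    {e : V} (he : e ∈ l) (s : ℝ) (z : V) : avgList l G (z + s • e) = avgList l G z := by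
  induction l generalizing z with
  | nil => simp at he
  | cons e' l ih =>
    have hl' : ∀ e ∈ l, proj e = 0 := fun e h => hl e (List.mem_cons_of_mem _ h)
    rcases List.mem_cons.1 he with rfl | he
    · exact dirInt_one_add_smul (avgList_add_right l (hG e (hl e he))) z s
    · exact dirInt_add_right (ih hl' he) z

lemma extDeriv_avgList (l : List V) {η : V → Alt k} (hη : ContDiff ℝ ∞ η) :
    extDeriv (avgList l η) = avgList l (extDeriv η) := by
  induction l with
  | nil => rfl
  | cons e l ih =>
    rw [avgList, avgList, extDeriv_dirInt continuous_const e (contDiff_avgList l hη), ih]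

/-- The one-direction homotopies telescope, because each intermediate average is still closed.
Periodicity of the primitive lets it descend to `M`. -/
lemma exists_avgList_eq_add_extDeriv (l : List V) {η : V → Alt (k + 1)} (hη : ContDiff ℝ ∞ η)
    (hper : IsPeriodic η) (hc : extDeriv η = 0) :
    ∃ θ : V → Alt k, ContDiff ℝ ∞ θ ∧ IsPeriodic θ ∧ avgList l η = η + extDeriv θ := by
  induction l with
  | nil =>
    refine ⟨fun _ => 0, contDiff_const, fun _ _ _ => rfl, ?_⟩
    rw [extDeriv_const_form, avgList, add_zero]
  | cons e l ih =>
    obtain ⟨θ, hθ, hθp, h⟩ := ih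
    have hs := contDiff_avgList l hη
    have hcl : extDeriv (avgList l η) = 0 := by
      rw [extDeriv_avgList l hη, hc]
      exact avgList_const l 0
    have hK : ContDiff ℝ ∞ (dirInt (fun t => 1 - t) e fun x => contract e (avgList l η x)) :=
      contDiff_dirInt (by fun_prop) e ((contract e).contDiff.comp hs)
    refine ⟨θ + dirInt (fun t => 1 - t) e fun x => contract e (avgList l η x),
      hθ.add hK, fun v hv z => ?_, ?_⟩
    · simp only [Pi.add_apply, hθp v hv]
      congr 1
      refine dirInt_add_right (fun x => ?_) z
      rw [avgList_add_right l (hper v hv)]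
    · rw [avgList, dirInt_one_eq_add_extDeriv e hs hcl]
      funext z
      rw [Pi.add_apply, Pi.add_apply, extDeriv_add (hθ.differentiable (by simp) z)
        (hK.differentiable (by simp) z), h, Pi.add_apply, add_assoc]

end AvgList

/-- The six generators of the lattice of periods of `M`. -/
def periods : List V :=
  [Pi.single 0 1, Pi.single 0 omega, Pi.single 1 1, Pi.single 1 omega, Pi.single 2 1,
    Pi.single 2 omega]

lemma proj_single {i : Fin 3} {x : ℂ} (hx : x ∈ lattice) : proj (Pi.single i x) = 0 := by
  funext j
  refine (QuotientAddGroup.eq_zero_iff _).2 ?_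
  rcases eq_or_ne j i with rfl | h
  · simpa using hx
  · simp [Pi.single_eq_of_ne h]

lemma proj_of_mem_periods : ∀ e ∈ periods, proj e = 0 := by
  have h1 : (1 : ℂ) ∈ lattice := AddSubgroup.subset_closure (by simp)
  have h2 : omega ∈ lattice := AddSubgroup.subset_closure (by simp)
  simp only [periods, List.mem_cons, List.not_mem_nil, or_false]
  rintro e (rfl | rfl | rfl | rfl | rfl | rfl) <;> exact proj_single ‹_›

lemma exists_eq_add_mul_omega (x : ℂ) : ∃ s t : ℝ, x = s + t * omega := by
  have h3 : Real.sqrt 3 ≠ 0 := by simp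
  -- The imaginary part of `omega` is `√3 / 2`, which fixes `t`; its real part `-1/2` then gives `s
  -- = x.re + t / 2`.
  refine ⟨x.re + x.im / Real.sqrt 3, 2 * x.im / Real.sqrt 3, ?_⟩
  apply Complex.ext <;> simp [omega] <;> field_simp
  ring

/-- The six periods span `ℂ³` over `ℝ`, so invariance along each of them forces the average to be
constant. -/
lemma avgList_periods_eq {F : Type} [NormedAddCommGroup F] [NormedSpace ℝ F] {G : V → F}
    (hG : IsPeriodic G) (z : V) : avgList periods G z = avgList periods G 0 := by
  choose s t hst using fun i => exists_eq_add_mul_omega (z i)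
  have hz : z = (0 : V) + s 0 • (Pi.single 0 1 : V) + t 0 • (Pi.single 0 omega : V) +
      s 1 • (Pi.single 1 1 : V) + t 1 • (Pi.single 1 omega : V) + s 2 • (Pi.single 2 1 : V) +
      t 2 • (Pi.single 2 omega : V) := by
    funext i
    rw [hst i]
    fin_cases i <;> simp
  have key : ∀ e ∈ periods, ∀ (r : ℝ) (x : V),
      avgList periods G (x + r • e) = avgList periods G x :=
    fun e he r x => avgList_add_smul hG proj_of_mem_periods he r x
  rw [hz]
  simp only [periods, List.mem_cons, List.not_mem_nil, or_false, forall_eq_or_imp,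
    forall_eq] at key
  obtain ⟨h1, h2, h3, h4, h5, h6⟩ := key
  simp only [periods]
  rw [h6, h5, h4, h3, h2, h1]

end Forms

/-! ### The cohomology of `M` is represented by constant forms -/

/-- The smooth form on `M` with constant coefficients. -/
def constForm (k : ℕ) : Alt k →ₗ[ℂ] Form k where
  toFun c := ⟨fun _ => c, (contDiff_const : ContDiff ℝ ∞ fun _ : V => c)⟩
  map_add' _ _ := rfl
  map_smul' _ _ := rfl

lemma d_constForm {k : ℕ} (c : Alt k) : d k (constForm k c) = 0 := by
  apply Subtype.ext
  apply lift_injective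
  exact (lift_extD _).trans (extDeriv_const_form c)

/-- The closed form on `M` with constant coefficients. -/
def constClosed (k : ℕ) : Alt k →ₗ[ℂ] Closed k :=
  (constForm k).codRestrict _ fun c => LinearMap.mem_ker.2 (d_constForm c)

/-- The cohomology class of a constant form. -/
def constClass (k : ℕ) : Alt k →ₗ[ℂ] DeRham k := (Submodule.mkQ _).comp (constClosed k)

lemma isPeriodic_lift {k : ℕ} (η : M → Alt k) : IsPeriodic (lift η) := fun l hl z => by
  simp only [lift]
  rw [proj_add, hl, add_zero]

lemma exists_lift_eq {k : ℕ} {θ : V → Alt k} (hθ : ContDiff ℝ ∞ θ) (hp : IsPeriodic θ) :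
    ∃ ζ : Form k, lift ζ.1 = θ := by
  have h : lift (fun x => θ (Function.surjInv proj_surjective x)) = θ := by
    funext z
    have h0 : proj (Function.surjInv proj_surjective (proj z) - z) = 0 := by
      rw [proj_sub, Function.surjInv_eq proj_surjective, sub_self]
    simpa [lift] using hp _ h0 z
  refine ⟨⟨fun x => θ (Function.surjInv proj_surjective x), ?_⟩, h⟩
  change ContDiff ℝ ∞ (lift fun x => θ (Function.surjInv proj_surjective x))
  rwa [h]

lemma lift_d {k : ℕ} (η : Form k) : lift (d k η).1 = extDeriv (lift η.1) := lift_extD _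

/-- A closed form is cohomologous to its full average, whose coefficients are constant; the periodic
primitive supplies the exact form on `M`. -/
lemma constClass_surjective (k : ℕ) : Function.Surjective (constClass (k + 1)) := by
  intro x
  obtain ⟨η, rfl⟩ := Submodule.mkQ_surjective _ x
  have hc : extDeriv (lift η.1.1) = 0 := by
    rw [← lift_d, LinearMap.mem_ker.1 η.2]
    rfl
  obtain ⟨θ, hθ, hθp, h⟩ := exists_avgList_eq_add_extDeriv periods (Form.contDiff η.1.2)
    (isPeriodic_lift η.1.1) hc
  obtain ⟨ζ, hζ⟩ := exists_lift_eq hθ hθp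
  refine ⟨avgList periods (lift η.1.1) 0, ?_⟩
  refine (Submodule.Quotient.eq _).2 ?_
  refine ⟨ζ, ?_⟩
  apply Subtype.ext
  apply lift_injective
  rw [lift_d, hζ]
  funext z
  have hz := congrFun h z
  rw [avgList_periods_eq (isPeriodic_lift _), Pi.add_apply] at hz
  exact (sub_eq_of_eq_add' hz).symm

/-- If `c = dθ`, averaging both sides gives `c = d(average of θ)`, and the average of `θ` is
constant. -/
lemma constClass_injective (k : ℕ) : Function.Injective (constClass (k + 1)) := by
  rw [injective_iff_map_eq_zero]
  intro c hc
  obtain ⟨θ, hθ⟩ := (Submodule.Quotient.mk_eq_zero _).1 hc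
  have h1 : extDeriv (lift θ.1) = fun _ => c := by
    rw [← lift_d, hθ]
    rfl
  have h2 := extDeriv_avgList periods (Form.contDiff θ.2)
  rw [h1, avgList_const,
    show avgList periods (lift θ.1) = fun _ => avgList periods (lift θ.1) 0 from
      funext fun z => avgList_periods_eq (isPeriodic_lift _) z] at h2
  rw [extDeriv_const_form] at h2
  exact (congrFun h2 0).symm

lemma constClass_bijective {k : ℕ} (hk : k ≠ 0) : Function.Bijective (constClass k) := by
  obtain ⟨k, rfl⟩ := Nat.exists_eq_succ_of_ne_zero hk
  exact ⟨constClass_injective k, constClass_surjective k⟩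

lemma finiteDimensional_alt (k : ℕ) : FiniteDimensional ℂ (Alt k) := by
  have h : FiniteDimensional ℝ (Alt k) := by
    let T : Alt k →ₗ[ℝ] MultilinearMap ℝ (fun _ : Fin k => V) ℂ :=
      { toFun := fun c => c.toMultilinearMap
        map_add' := fun _ _ => rfl
        map_smul' := fun _ _ => rfl }
    refine FiniteDimensional.of_injective T fun c c' h => ?_
    ext v
    exact DFunLike.congr_fun h v
  exact FiniteDimensional.right ℝ ℂ (Alt k)

/-- Finite dimension makes every point of the spectrum an eigenvalue. -/
lemma finiteDimensional_deRham {k : ℕ} (hk : k ≠ 0) : FiniteDimensional ℂ (DeRham k) := by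
  have := finiteDimensional_alt k
  exact Module.Finite.of_surjective (constClass k) (constClass_bijective hk).2

/-! ### The action of integer matrices on constant forms -/

/-- The linear lift to `ℂ³` of `matMap Q`. -/
def matCLM (Q : Matrix (Fin 3) (Fin 3) ℤ) : V →L[ℂ] V :=
  LinearMap.toContinuousLinearMap (Matrix.toLin' (Q.map (Int.castRingHom ℂ)))

lemma matCLM_apply (Q : Matrix (Fin 3) (Fin 3) ℤ) (v : V) :
    matCLM Q v = (Q.map (Int.castRingHom ℂ)).mulVec v := rfl

lemma proj_matCLM (Q : Matrix (Fin 3) (Fin 3) ℤ) (z : V) :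
    proj (matCLM Q z) = matMap Q (proj z) := by
  have h : matCLM Q z = fun i => ∑ j, Q i j • z j := by
    funext i
    simp [matCLM_apply, Matrix.mulVec, dotProduct]
  rw [h]
  funext i
  simp only [proj, matMap]
  exact map_sum (QuotientAddGroup.mk' lattice) _ _

lemma differential_matMap (Q : Matrix (Fin 3) (Fin 3) ℤ) (x : M) :
    differential (matMap Q) x = matCLM Q := by
  obtain ⟨z, rfl⟩ := proj_surjective x
  rw [differential_eq (F := matCLM Q)
    ⟨(matCLM Q).analyticAt z, Eventually.of_forall (proj_matCLM Q)⟩]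
  exact (matCLM Q).fderiv

lemma matCLM_pow_apply {Q : Matrix (Fin 3) (Fin 3) ℤ} {v : V} {μ : ℂ} (h : matCLM Q v = μ • v)
    (n : ℕ) : matCLM (Q ^ n) v = μ ^ n • v := by
  induction n with
  | zero =>
    simp [matCLM_apply]
  | succ n ih =>
    rw [matCLM_apply] at h ih ⊢
    rw [pow_succ, Matrix.map_mul, ← Matrix.mulVec_mulVec, h, Matrix.mulVec_smul, ih, smul_smul,
      pow_succ, mul_comm]

lemma iterate_matMap (Q : Matrix (Fin 3) (Fin 3) ℤ) (n : ℕ) :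
    (matMap Q)^[n] = matMap (Q ^ n) := by
  induction n with
  | zero =>
    funext x
    simp [matMap_one]
  | succ n ih =>
    funext x
    rw [Function.iterate_succ_apply, ih, matMap_matMap, pow_succ]

/-- The differential of `matMap Q` is the same linear map at every point, so pullback keeps constant
forms constant. -/
lemma pullbackDeRham_constClass (k : ℕ) (Q : Matrix (Fin 3) (Fin 3) ℤ)
    (hg : IsHolomorphic (matMap Q)) (c : Alt k) :
    pullbackDeRham k (matMap Q) hg (constClass k c) =
      constClass k (c.compContinuousLinearMap ((matCLM Q).restrictScalars ℝ)) := by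
  have h : pullbackClosed k (matMap Q) hg (constClosed k c) =
      constClosed k (c.compContinuousLinearMap ((matCLM Q).restrictScalars ℝ)) := by
    apply Subtype.ext
    apply Subtype.ext
    funext x
    change c.compContinuousLinearMap ((differential (matMap Q) x).restrictScalars ℝ) = _
    rw [differential_matMap]
    rfl
  exact congrArg (Submodule.mkQ _) h

/-! ### Eigenvalues and spectral radius on `H^{p,p}` -/

section Spectrum

variable {Q : Matrix (Fin 3) (Fin 3) ℤ} {b : Module.Basis (Fin 3) ℂ V} {ev : Fin 3 → ℝ}

/-- An eigenvalue of `Q` on constant forms is a product of eigenvalues of `Q` on `ℂ³`, each of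
them taken at most twice. -/
lemma eq_prod_of_comp_eq_smul {k : ℕ} (hb : ∀ i, matCLM Q (b i) = (ev i : ℂ) • b i) {c : Alt k}
    (hc : c ≠ 0) {μ : ℂ}
    (h : c.compContinuousLinearMap ((matCLM Q).restrictScalars ℝ) = μ • c) :
    ∃ s : Fin k → Fin 2 × Fin 3, Function.Injective s ∧ μ = ((∏ j, ev (s j).2 : ℝ) : ℂ) := by
  by_contra! hs
  apply hc
  -- The real basis `b i`, `I • b i`. As the `ev i` are real, real-multilinear forms can pull them
  -- out, and an alternating form is determined by its values on injective families of basis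
  -- vectors.
  let B : Module.Basis (Fin 2 × Fin 3) ℝ V := Complex.basisOneI.smulTower b
  have hB : ∀ q, matCLM Q (B q) = ev q.2 • B q := by
    intro q
    simp only [B, Module.Basis.smulTower_apply, map_smul, hb]
    rw [smul_comm]
    rfl
  apply ContinuousAlternatingMap.toAlternatingMap_injective
  refine Module.Basis.ext_alternating B fun s hsi => ?_
  change c (fun j => B (s j)) = 0
  have h1 := DFunLike.congr_fun h fun j => B (s j)
  have h2 : c (fun j => matCLM Q (B (s j))) = μ * c fun j => B (s j) := h1
  simp only [hB, c.map_smul_univ] at h2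
  have h3 := sub_ne_zero.2 (hs s hsi)
  refine (mul_eq_zero.1 (?_ : (μ - ((∏ j, ev (s j).2 : ℝ) : ℂ)) * c (fun j => B (s j)) = 0)
    ).resolve_left h3
  rw [sub_mul, ← h2, Complex.real_smul, sub_self]

/-- An eigenvector in `Hodge p p` is in particular the class of a constant form, which is itself an
eigenform. For this upper bound its type is irrelevant. -/
lemma eq_prod_of_mem_spectrum {p : ℕ} (hp : p ≠ 0)
    (hb : ∀ i, matCLM Q (b i) = (ev i : ℂ) • b i) (hg : IsHolomorphic (matMap Q)) {μ : ℂ}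
    (hμ : μ ∈ spectrum ℂ (pullbackHodge p p (matMap Q) hg)) :
    ∃ s : Fin (p + p) → Fin 2 × Fin 3, Function.Injective s ∧
      μ = ((∏ j, ev (s j).2 : ℝ) : ℂ) := by
  have hk : p + p ≠ 0 := by omega
  have := finiteDimensional_deRham hk
  obtain ⟨x, hx, hx0⟩ := (Module.End.hasEigenvalue_iff_mem_spectrum.2 hμ).exists_hasEigenvector
  rw [Module.End.mem_eigenspace_iff] at hx
  obtain ⟨c, hc⟩ := (constClass_bijective hk).2 x.1
  refine eq_prod_of_comp_eq_smul (c := c) hb ?_ ((constClass_bijective hk).1 ?_)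
  · rintro rfl
    exact hx0 (Subtype.ext (by rw [← hc, map_zero]; rfl))
  · rw [← pullbackDeRham_constClass (p + p) Q hg, map_smul, hc]
    exact congrArg Subtype.val hx

lemma mem_spectrum_of_comp_eq_smul {p : ℕ} (hp : p ≠ 0) (hg : IsHolomorphic (matMap Q))
    {c : Alt (p + p)} (hc : c ≠ 0) (ht : IsType p p c) {μ : ℂ}
    (h : c.compContinuousLinearMap ((matCLM Q).restrictScalars ℝ) = μ • c) :
    μ ∈ spectrum ℂ (pullbackHodge p p (matMap Q) hg) := by
  have hk : p + p ≠ 0 := by omega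
  have := finiteDimensional_deRham hk
  rw [← Module.End.hasEigenvalue_iff_mem_spectrum]
  have hm : constClass (p + p) c ∈ Hodge p p := ⟨constClosed (p + p) c, fun _ => ht, rfl⟩
  refine Module.End.hasEigenvalue_of_hasEigenvector (x := ⟨_, hm⟩) ⟨?_, ?_⟩
  · rw [Module.End.mem_eigenspace_iff]
    apply Subtype.ext
    change pullbackDeRham (p + p) (matMap Q) hg (constClass (p + p) c) =
      μ • constClass (p + p) c
    rw [pullbackDeRham_constClass, h, map_smul]
  · intro h0
    refine hc ((constClass_bijective hk).1 ?_)
    rw [map_zero]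
    exact congrArg Subtype.val h0

variable (b) in
/-- The real-linear coordinate functions `ℓ_i` and `conj ℓ_i` attached to a basis of `ℂ³`. -/
def coordOrConj (q : Fin 2 × Fin 3) (v : V) : ℂ :=
  if q.1 = 0 then b.coord q.2 v else starRingEnd ℂ (b.coord q.2 v)

lemma coordOrConj_add (q : Fin 2 × Fin 3) (v w : V) :
    coordOrConj b q (v + w) = coordOrConj b q v + coordOrConj b q w := by
  unfold coordOrConj; split_ifs <;> simp

lemma coordOrConj_smul (q : Fin 2 × Fin 3) (u : ℂ) (v : V) :
    coordOrConj b q (u • v) =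
      (if q.1 = 0 then u else starRingEnd ℂ u) * coordOrConj b q v := by
  unfold coordOrConj; split_ifs <;> simp

lemma coordOrConj_real_smul (q : Fin 2 × Fin 3) (r : ℝ) (v : V) :
    coordOrConj b q (r • v) = r • coordOrConj b q v := by
  unfold coordOrConj
  rw [← Complex.coe_smul]
  split_ifs <;> simp

lemma continuous_coordOrConj (q : Fin 2 × Fin 3) : Continuous (coordOrConj b q) := by
  have h : Continuous (b.coord q.2) := LinearMap.continuous_of_finiteDimensional _
  unfold coordOrConj
  split_ifs
  · exact h
  · exact Complex.continuous_conj.comp h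

/-- Because the eigenvalues are real, `ℓ_i` and its conjugate are scaled by the same factor. -/
lemma coordOrConj_matCLM (hb : ∀ i, matCLM Q (b i) = (ev i : ℂ) • b i) (q : Fin 2 × Fin 3)
    (v : V) : coordOrConj b q (matCLM Q v) = ev q.2 * coordOrConj b q v := by
  have h : b.coord q.2 (matCLM Q v) = ev q.2 * b.coord q.2 v := by
    have h1 : (b.coord q.2).comp (matCLM Q : V →ₗ[ℂ] V) = (ev q.2 : ℂ) • b.coord q.2 := by
      refine b.ext fun i => ?_
      rcases eq_or_ne i q.2 with rfl | hi
      · simp [hb]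
      · simp [hb, Finsupp.single_eq_of_ne hi.symm]
    exact LinearMap.congr_fun h1 v
  unfold coordOrConj
  split_ifs <;> simp [h]

variable (b) in
/-- The constant form `φ_{s 0} ∧ φ_{s 1} ∧ ⋯`, where the `φ_q` are the `coordOrConj b q`. -/
def wedgeForm {m : ℕ} (s : Fin m → Fin 2 × Fin 3) : Alt m :=
  let L : V →ₗ[ℝ] (Fin m → ℂ) :=
    { toFun := fun v k => coordOrConj b (s k) v
      map_add' := fun v w => funext fun k => coordOrConj_add _ v w
      map_smul' := fun r v => funext fun k => coordOrConj_real_smul _ r v }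
  { ((Matrix.detRowAlternating (n := Fin m) (R := ℂ)).toMultilinearMap.restrictScalars
      ℝ).compLinearMap fun _ => L with
    map_eq_zero_of_eq' := fun v i j hv hij => by
      change Matrix.det (Matrix.of fun i k => coordOrConj b (s k) (v i)) = 0
      exact Matrix.det_zero_of_row_eq hij (funext fun k => by simp [hv])
    cont := by
      change Continuous fun v : Fin m → V =>
        Matrix.det (Matrix.of fun i k => coordOrConj b (s k) (v i))
      refine Continuous.matrix_det (continuous_matrix fun i k => ?_)
      exact (continuous_coordOrConj (s k)).comp (continuous_apply i) }

lemma wedgeForm_apply {m : ℕ} (s : Fin m → Fin 2 × Fin 3) (v : Fin m → V) :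
    wedgeForm b s v = Matrix.det (Matrix.of fun i k => coordOrConj b (s k) (v i)) := rfl

/-- Each column of the determinant is multiplied by its own eigenvalue. -/
lemma wedgeForm_comp_matCLM {m : ℕ} (hb : ∀ i, matCLM Q (b i) = (ev i : ℂ) • b i)
    (s : Fin m → Fin 2 × Fin 3) :
    (wedgeForm b s).compContinuousLinearMap ((matCLM Q).restrictScalars ℝ) =
      (∏ k, (ev (s k).2 : ℂ)) • wedgeForm b s := by
  ext v
  change wedgeForm b s (fun i => matCLM Q (v i)) = _ * wedgeForm b s v
  simp only [wedgeForm_apply, coordOrConj_matCLM hb]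
  exact Matrix.det_mul_row (fun k => (ev (s k).2 : ℂ)) (fun i k => coordOrConj b (s k) (v i))

/-- Column scaling again: holomorphic factors contribute `u` and conjugate ones `ū`, so the type can
be read off from `s`. -/
lemma wedgeForm_smul {m : ℕ} (s : Fin m → Fin 2 × Fin 3) (u : ℂ) (v : Fin m → V) :
    wedgeForm b s (fun i => u • v i) =
      (∏ k, if (s k).1 = 0 then u else starRingEnd ℂ u) * wedgeForm b s v := by
  simp only [wedgeForm_apply, coordOrConj_smul]
  exact Matrix.det_mul_row (fun k => if (s k).1 = 0 then u else starRingEnd ℂ u)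
    (fun i k => coordOrConj b (s k) (v i))

/-- Every eigenvalue is one of the products bounded by `R`, and the nonzero `(p,p)`-form `wedgeForm
b s` realizes `R` itself. -/
lemma specRad_matMap_eq {p : ℕ} (hp : p ≠ 0) (hb : ∀ i, matCLM Q (b i) = (ev i : ℂ) • b i)
    (hg : IsHolomorphic (matMap Q)) {R : ℝ}
    (hle : ∀ s : Fin (p + p) → Fin 2 × Fin 3, Function.Injective s → |∏ j, ev (s j).2| ≤ R)
    (s : Fin (p + p) → Fin 2 × Fin 3) (h0 : wedgeForm b s ≠ 0) (ht : IsType p p (wedgeForm b s))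
    (hs : ∏ j, ev (s j).2 = R) : specRad p (matMap Q) hg = ENNReal.ofReal R := by
  apply le_antisymm
  · refine iSup₂_le fun μ hμ => ?_
    obtain ⟨s, hsi, rfl⟩ := eq_prod_of_mem_spectrum hp hb hg hμ
    rw [← enorm_eq_nnnorm, ← ofReal_norm, Complex.norm_real]
    exact ENNReal.ofReal_le_ofReal (hle s hsi)
  · have hm := mem_spectrum_of_comp_eq_smul hp hg h0 ht (wedgeForm_comp_matCLM hb s)
    refine le_trans ?_ (le_iSup₂ (f := fun (k : ℂ) (_ : k ∈ spectrum ℂ _) => (‖k‖₊ : ℝ≥0∞)) _ hm)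
    rw [← enorm_eq_nnnorm, ← ofReal_norm, ← Complex.ofReal_prod, hs, Complex.norm_real]
    exact ENNReal.ofReal_le_ofReal (le_abs_self R)

/-- `ℓ₀ ∧ conj ℓ₀`. -/
def idxOne : Fin (1 + 1) → Fin 2 × Fin 3 := ![(0, 0), (1, 0)]

/-- `ℓ₀ ∧ conj ℓ₀ ∧ ℓ₂ ∧ conj ℓ₂`. -/
def idxTwo : Fin (2 + 2) → Fin 2 × Fin 3 := ![(0, 0), (1, 0), (0, 2), (1, 2)]

lemma isType_wedgeForm_idxOne : IsType 1 1 (wedgeForm b idxOne) := by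
  intro u v
  rw [wedgeForm_smul]
  simp [Fin.prod_univ_succ, idxOne]

lemma isType_wedgeForm_idxTwo : IsType 2 2 (wedgeForm b idxTwo) := by
  intro u v
  rw [wedgeForm_smul]
  simp [Fin.prod_univ_succ, idxTwo]
  left
  ring

lemma wedgeForm_idxOne_ne_zero : wedgeForm b idxOne ≠ 0 := by
  intro h
  -- The matrix of values has rows `(1, 1)` and `(i, -i)`, with determinant `-2i`.
  have h1 := DFunLike.congr_fun h (![b 0, Complex.I • b 0] : Fin 2 → V)
  rw [wedgeForm_apply] at h1
  simp [idxOne, coordOrConj, Matrix.det_fin_two] at h1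
  have h2 := congrArg Complex.im h1
  norm_num at h2

lemma wedgeForm_idxTwo_ne_zero : wedgeForm b idxTwo ≠ 0 := by
  intro h
  -- Here the matrix of values is block diagonal with two copies of the block with rows `(1, 1)` and
  -- `(i, -i)`, so the determinant is `(-2i)² = -4`.
  have h1 := DFunLike.congr_fun h
    (![b 0, Complex.I • b 0, b 2, Complex.I • b 2] : Fin 4 → V)
  rw [wedgeForm_apply] at h1
  have h3 : Fin.succAbove (1 : Fin (2 + 2)) (2 : Fin 3) = 3 := rfl
  simp [idxTwo, coordOrConj, Matrix.det_succ_row_zero, Fin.sum_univ_succ, h3] at h1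

end Spectrum

/-! ### From spectral radii to dynamical degrees -/

lemma isDynamicalDegree_of_specRad_eq {p : ℕ} {g : Aut} {R : ℝ} (hR : 0 ≤ R)
    (h : ∀ n : ℕ, specRad p g.toFun^[n] (g.hol.iterate n) = ENNReal.ofReal (R ^ n)) :
    IsDynamicalDegree p g R := by
  refine ⟨hR, tendsto_const_nhds.congr' ?_⟩
  -- At `n = 0` the exponent `1 / 0` is `0`, so the root is `1` and not `R`; every other term equals
  -- `R`.
  filter_upwards [eventually_ne_atTop 0] with n hn
  rw [h, ENNReal.ofReal_pow hR, one_div, ENNReal.pow_rpow_inv_natCast hn]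

lemma specRad_congr {p : ℕ} {g h : M → M} (e : g = h) (hg : IsHolomorphic g)
    (hh : IsHolomorphic h) : specRad p g hg = specRad p h hh := by
  subst e
  rfl

/-- The dynamical degrees of an automorphism given by an integer matrix of determinant `±1` with
three real eigenvalues. -/
lemma isDynamicalDegree_autOfGL {A : GL (Fin 3) ℤ} {b : Module.Basis (Fin 3) ℂ V}
    {α β γ : ℝ} (h0 : matCLM A.val (b 0) = (α : ℂ) • b 0)
    (h1 : matCLM A.val (b 1) = (β : ℂ) • b 1) (h2 : matCLM A.val (b 2) = (γ : ℂ) • b 2)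
    (hβγ : |β| ≤ |γ|) (hγα : |γ| ≤ |α|) (hprod : |α * β * γ| = 1) :
    IsDynamicalDegree 1 (autOfGL A) (α ^ 2) ∧
      IsDynamicalDegree 2 (autOfGL A) (α ^ 2 * γ ^ 2) := by
  have hb : ∀ (n : ℕ) (i : Fin 3),
      matCLM (A.val ^ n) (b i) = ((![α, β, γ] i ^ n : ℝ) : ℂ) • b i := by
    intro n i
    rw [Complex.ofReal_pow]
    refine matCLM_pow_apply ?_ n
    fin_cases i <;> assumption
  have hiter : ∀ n : ℕ, (autOfGL A).toFun^[n] = matMap (A.val ^ n) := iterate_matMap A.val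
  have habs : ∀ {k : ℕ} (s : Fin k → Fin 2 × Fin 3) (n : ℕ),
      |∏ j, ![α, β, γ] (s j).2 ^ n| = (∏ j, |![α, β, γ] (s j).2|) ^ n := by
    intro k s n
    rw [Finset.prod_pow, abs_pow, Finset.abs_prod]
  have hmax : ∀ i, |![α, β, γ] i| ≤ |α| := by
    intro i
    fin_cases i
    · exact le_rfl
    · exact hβγ.trans hγα
    · exact hγα
  have hmin : ∀ i, |β| ≤ |![α, β, γ] i| := by
    intro i
    fin_cases i
    · exact hβγ.trans hγα
    · exact le_rfl
    · exact hβγ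
  constructor
  · refine isDynamicalDegree_of_specRad_eq (sq_nonneg α) fun n => ?_
    rw [specRad_congr (hiter n) _ (isHolomorphic_matMap _)]
    refine specRad_matMap_eq one_ne_zero (hb n) _ (fun s _ => ?_) idxOne
      wedgeForm_idxOne_ne_zero isType_wedgeForm_idxOne ?_
    · rw [habs]
      refine pow_le_pow_left₀ (Finset.prod_nonneg fun _ _ => abs_nonneg _) ?_ n
      refine (Finset.prod_le_prod (fun _ _ => abs_nonneg _) fun j _ => hmax (s j).2).trans ?_
      simp
    · simp [idxOne, Fin.prod_univ_succ]
      ring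
  · refine isDynamicalDegree_of_specRad_eq (by positivity) fun n => ?_
    rw [specRad_congr (hiter n) _ (isHolomorphic_matMap _)]
    refine specRad_matMap_eq two_ne_zero (hb n) _ (fun s hs => ?_) idxTwo
      wedgeForm_idxTwo_ne_zero isType_wedgeForm_idxTwo ?_
    · rw [habs]
      refine pow_le_pow_left₀ (Finset.prod_nonneg fun _ _ => abs_nonneg _) ?_ n
      -- Pass to the complement of the four chosen indices: it has two elements, so its product is
      -- at least `β²`, while the product over all six indices is `(αβγ)² = 1`. Hence the chosen
      -- product is at most `β⁻² = α²γ²`; the inequality is carried out without division.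
      let x : Fin 2 × Fin 3 → ℝ := fun q => |![α, β, γ] q.2|
      let S : Finset (Fin 2 × Fin 3) := Finset.univ.image s
      have hS : ∏ j, |![α, β, γ] (s j).2| = ∏ q ∈ S, x q :=
        (Finset.prod_image (f := x) fun i _ j _ h => hs h).symm
      have hcard : Sᶜ.card = 2 := by
        rw [Finset.card_compl, Finset.card_image_of_injective _ hs]
        simp
      have hall : (∏ q ∈ S, x q) * ∏ q ∈ Sᶜ, x q = 1 := by
        rw [Finset.prod_mul_prod_compl, Fintype.prod_prod_type]
        simp only [x, Fin.prod_univ_two, Fin.prod_univ_three]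
        simp [← abs_mul, hprod]
      have hlow : |β| ^ 2 ≤ ∏ q ∈ Sᶜ, x q := by
        have := Finset.prod_le_prod (s := Sᶜ) (f := fun _ => |β|) (g := x)
          (fun _ _ => abs_nonneg _) fun q _ => hmin q.2
        rwa [Finset.prod_const, hcard] at this
      have hpos : 0 ≤ ∏ q ∈ S, x q := Finset.prod_nonneg fun _ _ => abs_nonneg _
      have hsq : α ^ 2 * γ ^ 2 * |β| ^ 2 = 1 := by
        have : (α * β * γ) ^ 2 = 1 := by rw [← sq_abs, hprod, one_pow]
        rw [sq_abs]
        linear_combination this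
      rw [hS]
      calc ∏ q ∈ S, x q = α ^ 2 * γ ^ 2 * ((∏ q ∈ S, x q) * |β| ^ 2) := by
            linear_combination -(∏ q ∈ S, x q) * hsq
        _ ≤ α ^ 2 * γ ^ 2 * ((∏ q ∈ S, x q) * ∏ q ∈ Sᶜ, x q) := by gcongr
        _ = α ^ 2 * γ ^ 2 := by rw [hall, mul_one]
    · simp [idxTwo, Fin.prod_univ_succ]
      ring

/-! ### The matrices `P a` -/

lemma charpoly_P (a : ℕ) :
    (P a).val.charpoly = X ^ 3 - C (3 * (a : ℤ) ^ 2) * X + 1 := by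
  rw [Matrix.charpoly, Matrix.det_fin_three]
  simp [P]
  ring

/-- The polynomial `x³ - 3 A x + 1` has three real roots when `A ≥ 1`. -/
lemma exists_roots {A : ℝ} (hA : 1 ≤ A) : ∃ α β γ : ℝ,
    α ^ 3 - 3 * A * α + 1 = 0 ∧ β ^ 3 - 3 * A * β + 1 = 0 ∧ γ ^ 3 - 3 * A * γ + 1 = 0 ∧
    0 < β ∧ β < 1 ∧ 1 < γ ∧ γ < -α := by
  have hcont : Continuous fun x : ℝ => x ^ 3 - 3 * A * x + 1 := by fun_prop
  -- At `0` and at `±r` the cubic equals `1`; at `1` and at `-(r + 1)` it is negative. The roots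
  -- therefore lie in `(0, 1)`, `(1, r)` and `(-(r + 1), -r)`, and the negative one has the largest
  -- modulus.
  set r := Real.sqrt (3 * A) with hr
  have hr2 : r ^ 2 = 3 * A := Real.sq_sqrt (by linarith)
  have hr1 : 1 < r := by
    rw [hr, Real.lt_sqrt zero_le_one]; linarith
  obtain ⟨β, hβ, hβ0⟩ := intermediate_value_Ioo' (zero_le_one (α := ℝ)) hcont.continuousOn
    (show (0 : ℝ) ∈ Set.Ioo _ _ from ⟨by norm_num; linarith, by norm_num⟩)
  obtain ⟨γ, hγ, hγ0⟩ := intermediate_value_Ioo hr1.le hcont.continuousOn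
    (show (0 : ℝ) ∈ Set.Ioo _ _ from ⟨by norm_num; linarith, by
      rw [← hr2]; ring_nf; norm_num⟩)
  obtain ⟨α, hα, hα0⟩ := intermediate_value_Ioo (a := -(r + 1)) (b := -r) (by linarith)
    hcont.continuousOn (show (0 : ℝ) ∈ Set.Ioo _ _ from ⟨by
      simp only [← hr2]; nlinarith, by simp only [← hr2]; ring_nf; norm_num⟩)
  exact ⟨α, β, γ, hα0, hβ0, hγ0, hβ.1, hβ.2, hγ.1, by linarith [hγ.2, hα.2]⟩

/-- Vieta's formulas for three distinct roots of `x³ - 3 A x + 1`. -/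
lemma vieta {A α β γ : ℝ} (hα : α ^ 3 - 3 * A * α + 1 = 0) (hβ : β ^ 3 - 3 * A * β + 1 = 0)
    (hγ : γ ^ 3 - 3 * A * γ + 1 = 0) (hαβ : α ≠ β) (hβγ : β ≠ γ) (hαγ : α ≠ γ) :
    α + β + γ = 0 ∧ α * β + α * γ + β * γ = -(3 * A) ∧ α * β * γ = -1 := by
  -- Subtract the cubic equations in pairs and cancel the differences of roots; the same with the
  -- resulting quadratic relations gives the sum.
  have h1 : α ^ 2 + α * β + β ^ 2 = 3 * A :=
    mul_left_cancel₀ (sub_ne_zero.2 hαβ) (by linear_combination hα - hβ)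
  have h2 : β ^ 2 + β * γ + γ ^ 2 = 3 * A :=
    mul_left_cancel₀ (sub_ne_zero.2 hβγ) (by linear_combination hβ - hγ)
  have h3 : α + β + γ = 0 :=
    mul_left_cancel₀ (sub_ne_zero.2 hαγ) (by linear_combination h1 - h2)
  have h4 : γ = -α - β := by linear_combination h3
  subst h4
  refine ⟨h3, by linear_combination -h1, ?_⟩
  linear_combination hα - α * h1

/-- `P a` is a companion matrix: it sends `(1, x, x²)` to `(x, x², 3a²x - 1)`, and the last entry is
`x³` at a root. -/
lemma matCLM_P_eigenvector {a : ℕ} {x : ℝ} (hx : x ^ 3 - 3 * (a : ℝ) ^ 2 * x + 1 = 0) :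
    matCLM (P a).val ![1, (x : ℂ), (x : ℂ) ^ 2] = (x : ℂ) • ![1, (x : ℂ), (x : ℂ) ^ 2] := by
  have hxc : (x : ℂ) ^ 3 - 3 * (a : ℂ) ^ 2 * x + 1 = 0 := by exact_mod_cast hx
  rw [matCLM_apply]
  funext i
  fin_cases i
  · simp [P, Matrix.mulVec, dotProduct, Fin.sum_univ_three]
  · simp [P, Matrix.mulVec, dotProduct, Fin.sum_univ_three]
    ring
  · simp [P, Matrix.mulVec, dotProduct, Fin.sum_univ_three]
    linear_combination -hxc

/-- The vectors `(1, x_i, x_i²)` form a basis when the `x_i` are distinct. -/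
lemma exists_basis_vandermonde {x : Fin 3 → ℝ} (hx : Function.Injective x) :
    ∃ b : Module.Basis (Fin 3) ℂ V, ∀ i, b i = ![1, (x i : ℂ), (x i : ℂ) ^ 2] := by
  have hdet : (Matrix.vandermonde fun i => (x i : ℂ)).det ≠ 0 :=
    Matrix.det_vandermonde_ne_zero_iff.2 (Complex.ofReal_injective.comp hx)
  have hli : LinearIndependent ℂ (Matrix.vandermonde fun i => (x i : ℂ)).row :=
    Matrix.linearIndependent_rows_of_det_ne_zero hdet
  refine ⟨basisOfLinearIndependentOfCardEqFinrank hli (by simp), fun i => ?_⟩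
  rw [coe_basisOfLinearIndependentOfCardEqFinrank]
  funext j
  fin_cases j <;> simp [Matrix.row, Matrix.vandermonde]

/-- The conjugates of `α²` lie among `α², β², γ²`, and none of these is `α⁻²`. -/
lemma not_isSalem_sq {A : ℤ} {α β γ : ℝ} (h1 : α + β + γ = 0)
    (h2 : α * β + α * γ + β * γ = -(3 * A)) (h3 : α * β * γ = -1)
    (hγ : 1 < |γ|) (hα : 1 < |α|) : ¬ IsSalem (α ^ 2) := by
  rintro ⟨-, -, hinv, -⟩
  -- The rational cubic with roots `α², β², γ²`: their elementary symmetric functions are `6A`,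
  -- `9A²` and `1`. It only has to be a multiple of the minimal polynomial.
  let q : ℚ[X] := X ^ 3 - C (6 * (A : ℚ)) * X ^ 2 + C (9 * (A : ℚ) ^ 2) * X - 1
  have hq : ∀ y : ℝ, aeval y q = (y - α ^ 2) * (y - β ^ 2) * (y - γ ^ 2) := by
    intro y
    have e1 : α ^ 2 + β ^ 2 + γ ^ 2 = 6 * A := by
      linear_combination (α + β + γ) * h1 - 2 * h2
    have e2 : α ^ 2 * β ^ 2 + α ^ 2 * γ ^ 2 + β ^ 2 * γ ^ 2 = 9 * A ^ 2 := by
      linear_combination (α * β + α * γ + β * γ - 3 * A) * h2 - 2 * (α * β * γ) * h1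
    have e3 : α ^ 2 * β ^ 2 * γ ^ 2 = 1 := by
      linear_combination (α * β * γ - 1) * h3
    simp [q]
    linear_combination y ^ 2 * e1 - y * e2 + e3
  have hdvd : minpoly ℚ (α ^ 2) ∣ q := minpoly.dvd _ _ (by rw [hq]; ring)
  have h0 := aeval_eq_zero_of_dvd_aeval_eq_zero hdvd hinv
  rw [hq] at h0
  have hα2 : 1 < α ^ 2 := (one_lt_sq_iff_one_lt_abs α).2 hα
  have hγ2 : 1 < γ ^ 2 := (one_lt_sq_iff_one_lt_abs γ).2 hγ
  have hi : (α ^ 2)⁻¹ < 1 := inv_lt_one_of_one_lt₀ hα2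
  -- The inverse is below `1`, while `α²` and `γ²` exceed `1`.
  have hβ : (α ^ 2)⁻¹ - β ^ 2 = 0 := by
    rcases mul_eq_zero.1 h0 with h0 | h0
    · exact (mul_eq_zero.1 h0).resolve_left (by linarith)
    · linarith
  have hm : α ^ 2 * β ^ 2 = 1 := by
    rw [← sub_eq_zero.1 hβ]
    exact mul_inv_cancel₀ (by linarith)
  have : γ ^ 2 = 1 := by linear_combination (α * β * γ - 1) * h3 - γ ^ 2 * hm
  linarith

end EisensteinTorus

end

theorem lemma4p3 (a : ℕ) (ha : 1 ≤ a) :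
    (EisensteinTorus.P a).val.charpoly = X ^ 3 - C (3 * (a : ℤ) ^ 2) * X + 1 ∧
    ∃ α β γ : ℝ,
      (EisensteinTorus.P a).val.charpoly.map (Int.castRingHom ℝ) =
        (X - C α) * (X - C β) * (X - C γ) ∧
      |β| < 1 ∧ 1 < |γ| ∧ |γ| < |α| ∧
      EisensteinTorus.IsDynamicalDegree 1 (EisensteinTorus.f a) (α ^ 2) ∧
      EisensteinTorus.IsDynamicalDegree 2 (EisensteinTorus.f a) (α ^ 2 * γ ^ 2) ∧
      1 < α ^ 2 ∧ α ^ 2 < α ^ 2 * γ ^ 2 ∧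
      ¬ EisensteinTorus.IsSalem (α ^ 2) := by
  open EisensteinTorus in
  refine ⟨charpoly_P a, ?_⟩
  have hA : (1 : ℝ) ≤ (a : ℝ) ^ 2 := one_le_pow₀ (by exact_mod_cast ha)
  obtain ⟨α, β, γ, hα, hβ, hγ, hβ0, hβ1, hγ1, hγα⟩ := exists_roots hA
  obtain ⟨e1, e2, e3⟩ := vieta hα hβ hγ (by linarith) (by linarith) (by linarith)
  have absβ : |β| = β := abs_of_pos hβ0
  have absγ : |γ| = γ := abs_of_pos (by linarith)
  have absα : |α| = -α := abs_of_neg (by linarith)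
  have hinj : Function.Injective ![α, β, γ] := by
    intro i j h
    fin_cases i <;> fin_cases j <;> simp at h ⊢ <;> linarith
  obtain ⟨b, hb⟩ := exists_basis_vandermonde hinj
  obtain ⟨d1, d2⟩ := isDynamicalDegree_autOfGL (A := P a) (b := b) (α := α) (β := β) (γ := γ)
    (by rw [hb]; exact matCLM_P_eigenvector hα) (by rw [hb]; exact matCLM_P_eigenvector hβ)
    (by rw [hb]; exact matCLM_P_eigenvector hγ) (by rw [absβ, absγ]; linarith)
    (by rw [absγ, absα]; linarith) (by rw [e3]; simp)
  have hα2 : 1 < α ^ 2 := (one_lt_sq_iff_one_lt_abs α).2 (by rw [absα]; linarith)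
  have hγ2 : 1 < γ ^ 2 := (one_lt_sq_iff_one_lt_abs γ).2 (by rw [absγ]; linarith)
  refine ⟨α, β, γ, ?_, by rw [absβ]; exact hβ1, by rw [absγ]; exact hγ1,
    by rw [absγ, absα]; exact hγα, d1, d2, hα2, by nlinarith,
    not_isSalem_sq (A := (a : ℤ) ^ 2) e1 (by push_cast; exact e2) e3 (by rw [absγ]; exact hγ1)
      (by rw [absα]; linarith)⟩
  -- Vieta's relations as identities of constant polynomials, so that the factorization becomes a
  -- linear combination of them.
  have c1 : (C α + C β + C γ : ℝ[X]) = 0 := by rw [← C_add, ← C_add, e1, C_0]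
  have c2 : (C α * C β + C α * C γ + C β * C γ : ℝ[X]) = -C (3 * (a : ℝ) ^ 2) := by
    rw [← C_mul, ← C_mul, ← C_mul, ← C_add, ← C_add, e2, C_neg]
  have c3 : (C α * C β * C γ : ℝ[X]) = -1 := by rw [← C_mul, ← C_mul, e3, C_neg, C_1]
  rw [charpoly_P]
  have : (X ^ 3 - C (3 * (a : ℤ) ^ 2) * X + 1 : ℤ[X]).map (Int.castRingHom ℝ) =
      X ^ 3 - C (3 * (a : ℝ) ^ 2) * X + 1 := by
    simp only [Polynomial.map_add, Polynomial.map_sub, Polynomial.map_mul, Polynomial.map_pow,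
      map_X, map_C, Polynomial.map_one]
    simp only [eq_intCast, Int.cast_mul, Int.cast_pow, Int.cast_natCast, Int.cast_ofNat]
  rw [this]
  linear_combination X ^ 2 * c1 - X * c2 + c3
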